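/- Let $n\ge 2$. By a convex polyhedron in $\mathbb{R}^n$ we mean a convex set whose intersection with every bounded convex polyhedron (the convex hull of a finite set) is again a bounded convex polyhedron; in particular, it may be unbounded, and every finite intersection of closed half-spaces is an example. It is called integer if all its vertices lie in $\mathbb{Z}^n$. For an $(n-1)$-dimensional set $F\subset\mathbb{R}^n$, the integer distance $\rho_{\mathrm{int}}(F,\boldsymbol 0)$ from $F$ to the origin is the index in $\mathbb{Z}^n$ of the smallest sublattice of $\mathbb{Z}^n$ containing $\mathbb{Z}^n\cap\operatorname{aff}(F)$. Theorem. Let $P\subset\mathbb{R}^n$ be an $n$-dimensional integer convex polyhedron not containing $\boldsymbol 0$. Let $\mathbf v$ be a vertex of $P$ lying in the interior of $\operatorname{conv}(P\cup\{\boldsymbol 0\})$, and let $\mathbf v$ be incident to exactly $m$ edges of $P$, parallel to the primitive vectors $\mathbf r_1,\dots,\mathbf r_m$ of $\mathbb{Z}^n$ (for bounded edges such vectors always exist; an unbounded edge at $\mathbf v$ is required to have a rational direction). Put $$\det \mathrm{St}_{\mathbf v}=\sum_{1\le i_1<\dots<i_n\le m}|\det(\mathbf r_{i_1},\dots,\mathbf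 r_{i_n})|.$$ Let $F$ be an $(n-1)$-dimensional face of $P$ containing $\mathbf v$. Suppose that $$\bigl(\mathbb{Z}^n\cap\operatorname{conv}(P\cup\{\boldsymbol 0\})\bigr)\setminus P=\{\boldsymbol 0\}.$$ Then $\rho_{\mathrm{int}}(F,\boldsymbol 0)$ is finite and $$\rho_{\mathrm{int}}(F,\boldsymbol 0)<(nm)^{4\cdot n!}\,\det \mathrm{St}_{\mathbf v}.$$ -/

import Mathlib

/-- The point of `ℝⁿ` with the given integer coordinates. -/
def intPt {n : ℕ} (z : Fin n → ℤ) : Fin n → ℝ := fun i => (z i : ℝ)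

/-- The lattice `ℤⁿ` as a subset of `ℝⁿ`. -/
def intLattice (n : ℕ) : Set (Fin n → ℝ) := Set.range (intPt (n := n))

/-- The dimension of (the affine hull of) a subset of `ℝⁿ`. -/
noncomputable def affDim {n : ℕ} (S : Set (Fin n → ℝ)) : ℕ :=
  Module.finrank ℝ (vectorSpan ℝ S)

/-- A convex polyhedron in the generalized sense: a convex set whose intersection with every
bounded convex polyhedron (the convex hull of a finite set) is again such a polyhedron.
Finite intersections of closed half-spaces are examples, bounded or not. -/
def IsConvexPolyhedron {n : ℕ} (P : Set (Fin n → ℝ)) : Prop :=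
  Convex ℝ P ∧
    ∀ T : Finset (Fin n → ℝ), ∃ S : Finset (Fin n → ℝ),
      P ∩ convexHull ℝ (T : Set (Fin n → ℝ)) = convexHull ℝ (S : Set (Fin n → ℝ))

/-- `F` is a `k`-dimensional face of `P`: a nonempty set of dimension `k` which is the set of all
points of `P` at which some linear functional attains its maximum over `P`. -/
def IsFaceOfDim {n : ℕ} (P F : Set (Fin n → ℝ)) (k : ℕ) : Prop :=
  F.Nonempty ∧ IsExposed ℝ P F ∧ affDim F = k

/-- `v` is a vertex of `P`. -/
def IsVertexOf {n : ℕ} (P : Set (Fin n → ℝ)) (v : Fin n → ℝ) : Prop :=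
  IsFaceOfDim P {v} 0

/-- An integer convex polyhedron: all its vertices are lattice points. -/
def IsIntegerConvexPolyhedron {n : ℕ} (P : Set (Fin n → ℝ)) : Prop :=
  IsConvexPolyhedron P ∧ ∀ v, IsVertexOf P v → v ∈ intLattice n

/-- The set of all edges of `P` incident to `v`. -/
def edgesAt {n : ℕ} (P : Set (Fin n → ℝ)) (v : Fin n → ℝ) : Set (Set (Fin n → ℝ)) :=
  {E | IsFaceOfDim P E 1 ∧ v ∈ E}

/-- A primitive vector of `ℤⁿ`: its coordinates have greatest common divisor `1`. -/
def IsPrimitiveVec {n : ℕ} (r : Fin n → ℤ) : Prop := Finset.univ.gcd r = 1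

/-- `r` is a primitive vector of `ℤⁿ` parallel to the edge `E`. -/
def IsPrimitiveDirection {n : ℕ} (E : Set (Fin n → ℝ)) (r : Fin n → ℤ) : Prop :=
  IsPrimitiveVec r ∧ intPt r ∈ vectorSpan ℝ E

/-- The determinant of an edge star whose edges are parallel to the primitive vectors
`r₁, …, rₘ`: the sum of `|det (r_{i₁}, …, r_{iₙ})|` over all `i₁ < ⋯ < iₙ`. -/
noncomputable def edgeStarDet {n m : ℕ} (r : Fin m → Fin n → ℤ) : ℕ :=
  ∑ i : Fin n ↪o Fin m, (Matrix.of fun j => r (i j)).det.natAbs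

/-- The smallest sublattice (subgroup) of `ℤⁿ` containing `ℤⁿ ∩ aff F - a`. -/
def distLattice {n : ℕ} (F : Set (Fin n → ℝ)) (a : Fin n → ℤ) : AddSubgroup (Fin n → ℤ) :=
  AddSubgroup.closure {w | intPt (w + a) ∈ affineSpan ℝ F}

/-- The integer distance from `F` to `a`: the index in `ℤⁿ` of the smallest sublattice
containing `ℤⁿ ∩ aff F - a` (it is `⊤` when the index is infinite). -/
noncomputable def integerDistance {n : ℕ} (F : Set (Fin n → ℝ)) (a : Fin n → ℤ) : ℕ∞ :=
  ENat.card ((Fin n → ℤ) ⧸ distLattice F a)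

/-! Let q_i = ±r_i be the edge directions oriented into `P`. An edge that stopped before v + q_i
would end at a vertex that is not a lattice point, so v + q_i ∈ P; and `P` lies in v + cone(q).
Since `v` is interior to the hull, (1+t)v is still in it for some t > 0, which puts `v` itself in
the cone: v = Σ d_i q_i with d ≥ 0 and, by Carathéodory, at most n nonzero d_i.

Arithmetic bounds L = 1 + Σ d_i. In the points 0 and v + q_i, `v` has weights 1/L and d_i/L. If L
were large, Diophantine approximation would give nonzero k ∈ ℕ^m with N = Σ k_i, N + 1 < L and k_i ≤
(N+1) d_i/L. Then v - Σ k_i q_i has nonnegative weights (N+1)/L and (N+1) d_i/L - k_i, so it is a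
lattice point of the hull. It is outside `P`, being on the wrong side of a supporting hyperplane at
`v`, and a sign check shows that it is not 0. This contradicts emptiness, so L ≤ n^(8·n!)
(`one_add_sum_le_of_empty`, resting on `exists_integer_vector_below`).

Geometry turns this into the distance. The direction of `F` is spanned by n - 1 independent q_i
(`exists_facet_basis`), so ψ(w) = det(w, those q_i) is an integer functional constant on aff F, and
the distance is at most |ψ(v)| (`enatCard_quotient_le_natAbs`). Each |ψ(q_i)| is at most the star
determinant, hence |ψ(v)| ≤ (L - 1) det St. A nonzero star determinant forces n ≤ m, and n² ≤ nm
gives the stated form. -/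

open Set Topology

/-! ### Diophantine approximation. -/

/-- Simultaneous approximation of a probability vector by integer vectors, the sum being
preserved. -/
theorem exists_simultaneous_approx {ι : Type*} [DecidableEq ι] (B : Finset ι) (hB : B.Nonempty)
    (ν : ι → ℝ) (hν : ∑ i ∈ B, ν i = 1) (T : ℕ) (hT : 0 < T) :
    ∃ (N : ℕ) (k : ι → ℤ), 1 ≤ N ∧ N ≤ T ^ (B.card - 1) ∧ ∑ i ∈ B, k i = N ∧
      ∀ i ∈ B, |N * ν i - k i| ≤ ((B.card - 1 : ℕ) : ℝ) / T := by
  obtain ⟨i₀, hi₀⟩ := hB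
  have hT' : (0 : ℝ) < T := by exact_mod_cast hT
  have hc : (B.erase i₀).card = B.card - 1 := Finset.card_erase_of_mem hi₀
  -- Dirichlet's pigeonhole: record which of T equal intervals contains each fractional part. The
  -- index i₀ is left out because the prescribed sum determines its integer; hence the exponent
  -- `B.card - 1`.
  let f : ℕ → (∀ i ∈ B.erase i₀, ℕ) := fun N i _ => ⌊(T : ℝ) * Int.fract (N * ν i)⌋₊
  have hmaps : Set.MapsTo f (Finset.range (T ^ (B.card - 1) + 1))
      ((B.erase i₀).pi fun _ => Finset.range T) := by
    intro N _
    simp only [Finset.mem_coe, Finset.mem_pi, Finset.mem_range, f]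
    intro i _
    rw [Nat.floor_lt (mul_nonneg hT'.le (Int.fract_nonneg _))]
    nlinarith [Int.fract_lt_one ((N : ℝ) * ν i)]
  have hcard : ((B.erase i₀).pi fun _ => Finset.range T).card <
      (Finset.range (T ^ (B.card - 1) + 1)).card := by
    simp [Finset.card_pi, hc]
  obtain ⟨a, ha, b, hb, hab, hf⟩ :=
    Finset.exists_ne_map_eq_of_card_lt_of_maps_to hcard hmaps
  wlog hlt : a < b generalizing a b
  · exact this b hb a ha hab.symm hf.symm (by omega)
  have key : ∀ i ∈ B.erase i₀,
      |((b - a : ℕ) : ℝ) * ν i - ((⌊(b : ℝ) * ν i⌋ - ⌊(a : ℝ) * ν i⌋ : ℤ) : ℝ)| ≤ 1 / T := by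
    intro i hi
    have h1 : ⌊(T : ℝ) * Int.fract (a * ν i)⌋₊ = ⌊(T : ℝ) * Int.fract (b * ν i)⌋₊ :=
      congrFun (congrFun hf i) hi
    have ha0 : 0 ≤ (T : ℝ) * Int.fract (a * ν i) := mul_nonneg hT'.le (Int.fract_nonneg _)
    have hb0 : 0 ≤ (T : ℝ) * Int.fract (b * ν i) := mul_nonneg hT'.le (Int.fract_nonneg _)
    have ha1 := Nat.floor_le ha0
    have ha2 := Nat.lt_floor_add_one ((T : ℝ) * Int.fract (a * ν i))
    have hb1 := Nat.floor_le hb0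
    have hb2 := Nat.lt_floor_add_one ((T : ℝ) * Int.fract (b * ν i))
    rw [h1] at ha1 ha2
    have he : ((b - a : ℕ) : ℝ) * ν i - ((⌊(b : ℝ) * ν i⌋ - ⌊(a : ℝ) * ν i⌋ : ℤ) : ℝ) =
        Int.fract (b * ν i) - Int.fract (a * ν i) := by
      rw [Nat.cast_sub hlt.le]
      simp only [Int.fract]
      push_cast
      ring
    have habs : |Int.fract (b * ν i) - Int.fract (a * ν i)| * T =
        |(Int.fract (b * ν i) - Int.fract (a * ν i)) * T| := by rw [abs_mul, abs_of_pos hT']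
    rw [he, le_div_iff₀ hT', habs, abs_le]
    constructor <;> linarith [mul_comm (T : ℝ) (Int.fract (b * ν i) - Int.fract (a * ν i)),
      mul_sub (T : ℝ) (Int.fract (b * ν i)) (Int.fract (a * ν i))]
  obtain ⟨g, key⟩ : ∃ g : ι → ℤ, ∀ i ∈ B.erase i₀, |((b - a : ℕ) : ℝ) * ν i - g i| ≤ 1 / T :=
    ⟨_, key⟩
  -- The entry at i₀ collects the errors of all the others, which is why the bound has numerator
  -- `B.card - 1`.
  let k : ι → ℤ := fun i => if i = i₀ then (b - a : ℕ) - ∑ i ∈ B.erase i₀, g i else g i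
  have hk : ∀ i ∈ B.erase i₀, k i = g i := fun i hi => if_neg (Finset.ne_of_mem_erase hi)
  have hk0 : k i₀ = (b - a : ℕ) - ∑ i ∈ B.erase i₀, g i := if_pos rfl
  refine ⟨b - a, k, by omega, ?_, ?_, ?_⟩
  · have := Finset.mem_range.1 hb
    omega
  · rw [← Finset.add_sum_erase B k hi₀, hk0, Finset.sum_congr rfl hk]
    ring
  · intro i hi
    by_cases h : i = i₀
    · subst h
      have hν' : ν i = 1 - ∑ j ∈ B.erase i, ν j := by
        rw [← Finset.add_sum_erase B ν hi] at hν
        linarith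
      have : ((b - a : ℕ) : ℝ) * ν i - k i =
          -∑ j ∈ B.erase i, (((b - a : ℕ) : ℝ) * ν j - (g j : ℤ)) := by
        rw [Finset.sum_sub_distrib, ← Finset.mul_sum, hk0, hν']
        push_cast
        ring
      rw [this, abs_neg]
      refine (Finset.abs_sum_le_sum_abs _ _).trans ((Finset.sum_le_sum key).trans ?_)
      rw [Finset.sum_const, hc, nsmul_eq_mul, mul_one_div]
    · have hi' : i ∈ B.erase i₀ := Finset.mem_erase.2 ⟨h, hi⟩
      rw [hk i hi']
      refine (key i hi').trans ?_
      have : 1 ≤ B.card - 1 := hc ▸ Finset.card_pos.2 ⟨i, hi'⟩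
      gcongr
      exact_mod_cast this

/-- If the thresholds `τ` decrease, then some set of indices of size `j` is separated from the
others by the thresholds `τ j` and `τ (j + 1)`. -/
theorem exists_threshold_set {ι : Type*} [Fintype ι] [DecidableEq ι] (μ : ι → ℝ) (τ : ℕ → ℝ)
    (hτ : Antitone τ) (h1 : ∃ i, τ 1 ≤ μ i) :
    ∃ B : Finset ι, B.Nonempty ∧ (∀ i ∈ B, τ B.card ≤ μ i) ∧ ∀ i ∉ B, μ i < τ (B.card + 1) := by
  classical
  obtain ⟨i, hi⟩ := h1
  -- In a set of maximal size, an outside index reaching the next threshold could be adjoined, since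
  -- lower thresholds only help the old members.
  let S : Finset (Finset ι) := Finset.univ.filter fun B => B.Nonempty ∧ ∀ i ∈ B, τ B.card ≤ μ i
  have hS : S.Nonempty := ⟨{i}, by simp [S, hi]⟩
  obtain ⟨B, hBS, hmax⟩ := S.exists_max_image Finset.card hS
  simp only [S, Finset.mem_filter, Finset.mem_univ, true_and] at hBS hmax
  refine ⟨B, hBS.1, hBS.2, fun j hj => ?_⟩
  by_contra! hle
  have hc : (insert j B).card = B.card + 1 := Finset.card_insert_of_notMem hj
  have := hmax (insert j B) ⟨Finset.insert_nonempty _ _, fun i hi => ?_⟩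
  · omega
  · rw [hc]
    rcases Finset.mem_insert.1 hi with rfl | h
    · exact hle
    · exact (hτ (Nat.le_succ _)).trans (hBS.2 i h)

/-- This is the recursion that the thresholds n^(-8·(j-1)!) must satisfy: the next one has to beat
3n times the Dirichlet bound T^(j-1), where T = 2n·n^(8·(j-1)!). The factor j in the exponent
recursion produces the factorial. -/
theorem threshold_growth (n j : ℕ) (hn : 2 ≤ n) (hj : 1 ≤ j) :
    3 * n * (2 * n * n ^ (8 * (j - 1).factorial)) ^ (j - 1) ≤ n ^ (8 * j.factorial) := by
  obtain ⟨i, rfl⟩ : ∃ i, j = i + 1 := ⟨j - 1, by omega⟩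
  simp only [Nat.add_sub_cancel]
  have h1 : 3 * n ≤ n ^ 3 := by nlinarith [Nat.mul_le_mul hn hn]
  have h2 : 2 * n ≤ n ^ 2 := by nlinarith
  calc 3 * n * (2 * n * n ^ (8 * i.factorial)) ^ i
      ≤ n ^ 3 * (n ^ 2 * n ^ (8 * i.factorial)) ^ i := by gcongr
    _ = n ^ (3 + (2 + 8 * i.factorial) * i) := by rw [← pow_add, ← pow_mul, ← pow_add]
    _ ≤ n ^ (8 * (i + 1).factorial) := by
        apply Nat.pow_le_pow_right (by omega)
        rw [Nat.factorial_succ]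
        have h4 : i ≤ i.factorial := Nat.self_le_factorial i
        have h5 : 1 ≤ i.factorial := Nat.factorial_pos i
        nlinarith

/-- If the nonnegative numbers `lam i`, at most `n` of which are nonzero, have a large sum, then
some multiple of the vector `lam / (1 + ∑ lam)` is close to an integer vector from above. -/
theorem exists_integer_vector_below {ι : Type*} [Fintype ι] [DecidableEq ι] (n : ℕ) (hn : 2 ≤ n)
    (s : Finset ι) (hs : s.card ≤ n) (lam : ι → ℝ) (h0 : ∀ i, 0 ≤ lam i)
    (hsupp : ∀ i ∉ s, lam i = 0)
    (hbig : ((n ^ (8 * n.factorial) : ℕ) : ℝ) < 1 + ∑ i, lam i) :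
    ∃ k : ι → ℕ, 1 ≤ ∑ i, k i ∧ ((∑ i, k i : ℕ) : ℝ) < ∑ i, lam i ∧
      ∀ i, (k i : ℝ) * (1 + ∑ i, lam i) ≤ ((∑ i, k i : ℕ) + 1) * lam i := by
  set L : ℝ := 1 + ∑ i, lam i with hL
  have hn0 : (0 : ℝ) < n := by positivity
  have hn2 : (2 : ℝ) ≤ n := by exact_mod_cast hn
  have hpow : ∀ a b : ℕ, a ≤ b → n ^ a ≤ n ^ b := fun a b h => Nat.pow_le_pow_right (by omega) h
  let A : ℕ → ℕ := fun j => n ^ (8 * (j - 1).factorial)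
  have hA0 : ∀ j, (0 : ℝ) < A j := fun j => by simp only [A]; positivity
  let τ : ℕ → ℝ := fun j => 1 / A j
  have hτ : Antitone τ := by
    intro a b hab
    apply one_div_le_one_div_of_le (hA0 a)
    exact_mod_cast hpow _ _ (Nat.mul_le_mul_left 8 (Nat.factorial_le (by omega)))
  have hA1 : (n : ℝ) ^ 2 ≤ A 1 := by
    have := hpow 2 8 (by norm_num)
    simp only [A, Nat.sub_self, Nat.factorial_zero, mul_one]
    exact_mod_cast this
  have hLA : (A (n + 1) : ℝ) < L := by simpa [A] using hbig
  have hA1L : (A 1 : ℝ) < L := by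
    refine lt_of_le_of_lt ?_ hLA
    exact_mod_cast hpow _ _ (Nat.mul_le_mul_left 8 (Nat.factorial_le (by omega)))
  have hL4 : 4 < L := by nlinarith
  have hL0 : 0 < L := by linarith
  -- Otherwise at most n entries below n^(-8) would carry the mass 1 - 1/L, which exceeds 1/2.
  have hex : ∃ i, τ 1 ≤ lam i / L := by
    by_contra! hcon
    have h1 : ∑ i ∈ s, lam i ≤ s.card • (L * τ 1) := by
      apply Finset.sum_le_card_nsmul
      intro i _
      have := hcon i
      rw [div_lt_iff₀ hL0] at this
      linarith
    have h2 : ∑ i ∈ s, lam i = ∑ i, lam i :=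
      Finset.sum_subset (Finset.subset_univ s) fun i _ hi => hsupp i hi
    have h3 : (s.card : ℝ) ≤ n := by exact_mod_cast hs
    rw [h2, nsmul_eq_mul] at h1
    have h4 : L * τ 1 * (n : ℝ) ≤ L / 2 := by
      have : τ 1 * n ≤ 1 / 2 := by
        simp only [τ]
        rw [one_div_mul_eq_div, div_le_iff₀ (hA0 1)]
        nlinarith
      nlinarith
    have h5 : (s.card : ℝ) * (L * τ 1) ≤ n * (L * τ 1) := by
      gcongr
    linarith
  obtain ⟨B, hBne, hBge, hBlt⟩ := exists_threshold_set (fun i => lam i / L) τ hτ hex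
  set j := B.card with hj
  have hj1 : 1 ≤ j := Finset.card_pos.2 hBne
  have hBs : B ⊆ s := by
    intro i hi
    by_contra hc
    have := hBge i hi
    rw [hsupp i hc, zero_div] at this
    exact absurd this (not_le.2 (one_div_pos.2 (hA0 _)))
  have hjn : j ≤ n := (Finset.card_le_card hBs).trans hs
  -- the mass outside `B`
  set σ : ℝ := 1 - ∑ i ∈ B, lam i / L with hσ
  have hσ1 : σ = 1 / L + ∑ i ∈ s \ B, lam i / L := by
    have h1 : ∑ i ∈ s \ B, lam i / L + ∑ i ∈ B, lam i / L = ∑ i, lam i / L := by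
      rw [Finset.sum_sdiff hBs]
      exact Finset.sum_subset (Finset.subset_univ s) fun i _ hi => by rw [hsupp i hi, zero_div]
    have h2 : 1 / L + ∑ i, lam i / L = 1 := by
      rw [← Finset.sum_div, ← add_div, ← hL, div_self hL0.ne']
    rw [hσ]
    linarith
  have hσL : 1 / L ≤ σ := by
    rw [hσ1]
    have : 0 ≤ ∑ i ∈ s \ B, lam i / L :=
      Finset.sum_nonneg fun i _ => div_nonneg (h0 i) hL0.le
    linarith
  have hσ0 : 0 < σ := lt_of_lt_of_le (one_div_pos.2 hL0) hσL
  -- The origin's weight 1/L counts as one more small entry; as `B` is nonempty, at most n small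
  -- entries remain.
  have hσup : σ ≤ n * τ (j + 1) := by
    have h1 : 1 / L ≤ τ (j + 1) :=
      (one_div_le_one_div_of_le (hA0 _) hLA.le).trans (hτ (by omega))
    have h2 : ∑ i ∈ s \ B, lam i / L ≤ (s \ B).card • τ (j + 1) :=
      Finset.sum_le_card_nsmul _ _ _ fun i hi => (hBlt i (Finset.mem_sdiff.1 hi).2).le
    have h3 : (s \ B).card + 1 ≤ n := by
      rw [Finset.card_sdiff_of_subset hBs]
      omega
    have h4 : ((s \ B).card : ℝ) + 1 ≤ n := by exact_mod_cast h3
    rw [nsmul_eq_mul] at h2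
    have h5 : 0 ≤ τ (j + 1) := one_div_nonneg.2 (hA0 _).le
    rw [hσ1]
    nlinarith
  -- This makes the approximation error at most half of τ j, hence at most half of every entry in
  -- `B`.
  set T : ℕ := 2 * n * A j with hT
  have hT0 : 0 < T := by
    have : 0 < A j := by exact_mod_cast hA0 j
    positivity
  have hTσ : (T : ℝ) ^ (j - 1) * σ ≤ 1 / 3 := by
    have hgr := threshold_growth n j hn hj1
    have h1 : (3 * n * T ^ (j - 1) : ℝ) ≤ A (j + 1) := by
      simp only [hT, A, Nat.add_sub_cancel]
      exact_mod_cast hgr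
    calc (T : ℝ) ^ (j - 1) * σ ≤ T ^ (j - 1) * (n * τ (j + 1)) := by gcongr
      _ = (3 * n * T ^ (j - 1)) / A (j + 1) / 3 := by simp only [τ]; ring
      _ ≤ 1 / 3 := by
        gcongr
        rw [div_le_one (hA0 _)]
        exact h1
  have hT1 : (1 : ℝ) ≤ (T : ℝ) ^ (j - 1) := one_le_pow₀ (by exact_mod_cast hT0)
  have hσ3 : σ ≤ 1 / 3 := by nlinarith
  have hB1 : ∑ i ∈ B, lam i / L = 1 - σ := by rw [hσ]; ring
  have h1σ : 0 < 1 - σ := by linarith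
  obtain ⟨N, k, hN1, hN2, hksum, hk⟩ := exists_simultaneous_approx B hBne
    (fun i => lam i / L / (1 - σ)) (by rw [← Finset.sum_div, hB1, div_self h1σ.ne']) T hT0
  have herr : ((j - 1 : ℕ) : ℝ) / T ≤ τ j / 2 := by
    have : ((j - 1 : ℕ) : ℝ) ≤ n := by exact_mod_cast (by omega : j - 1 ≤ n)
    rw [hT, div_le_iff₀ (by exact_mod_cast hT0)]
    simp only [τ]
    push_cast
    have h := (hA0 j).ne'
    field_simp
    exact this
  have hN2' : (N : ℝ) ≤ T ^ (j - 1) := by exact_mod_cast hN2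
  have hN1' : (1 : ℝ) ≤ N := by exact_mod_cast hN1
  have hNσ : N * σ ≤ 1 / 3 := (mul_le_mul_of_nonneg_right hN2' hσ0.le).trans hTσ
  have hμ0 : ∀ i, 0 ≤ lam i / L := fun i => div_nonneg (h0 i) hL0.le
  have hknonneg : ∀ i ∈ B, 0 ≤ k i := by
    intro i hi
    have h1 := (abs_le.1 ((hk i hi).trans herr)).2
    have h2 : lam i / L ≤ N * (lam i / L / (1 - σ)) := by
      rw [← mul_div_assoc, le_div_iff₀ h1σ]
      nlinarith [hμ0 i]
    have h3 := hBge i hi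
    have h4 : 0 < τ j := one_div_pos.2 (hA0 _)
    have h5 : (0 : ℝ) < k i := by linarith
    exact_mod_cast h5.le
  -- Write μ_i = lam i / L. Renormalising by 1 - σ costs at most μ_i/2, because Nσ and σ are at most
  -- 1/3; the approximation costs at most another μ_i/2. Together they use up the extra 1 in N + 1.
  have hkle : ∀ i ∈ B, (k i : ℝ) ≤ (N + 1) * (lam i / L) := by
    intro i hi
    have h1 := (abs_le.1 ((hk i hi).trans herr)).1
    have h3 := hBge i hi
    have h2 : N * (lam i / L / (1 - σ)) ≤ N * (lam i / L) + lam i / L / 2 := by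
      rw [← mul_div_assoc, div_le_iff₀ h1σ]
      nlinarith [hμ0 i, mul_le_mul_of_nonneg_right hNσ (hμ0 i),
        mul_le_mul_of_nonneg_right hσ3 (hμ0 i)]
    nlinarith
  have hsum : ∑ i, (if i ∈ B then (k i).toNat else 0) = N := by
    rw [← Finset.sum_filter, Finset.filter_mem_eq_inter, Finset.univ_inter]
    zify
    rw [← hksum]
    exact Finset.sum_congr rfl fun i hi => Int.toNat_of_nonneg (hknonneg i hi)
  refine ⟨fun i => if i ∈ B then (k i).toNat else 0, ?_⟩
  rw [hsum]
  refine ⟨hN1, ?_, fun i => ?_⟩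
  · have h1 : N * (1 / L) ≤ 1 / 3 := (mul_le_mul_of_nonneg_left hσL (by positivity)).trans hNσ
    rw [mul_one_div, div_le_iff₀ hL0] at h1
    linarith
  · by_cases hi : i ∈ B
    · simp only [hi, if_true]
      have h1 : ((k i).toNat : ℝ) = k i := by
        exact_mod_cast congrArg (Int.cast (R := ℝ)) (Int.toNat_of_nonneg (hknonneg i hi))
      rw [h1]
      have := hkle i hi
      rwa [← mul_div_assoc, le_div_iff₀ hL0] at this
    · simp only [hi, if_false, Nat.cast_zero, zero_mul]
      exact mul_nonneg (by positivity) (h0 i)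

/-! ### Carathéodory's theorem for cones. -/

section ConicCaratheodory

variable {ι V : Type*} [Fintype ι] [DecidableEq ι] [AddCommGroup V] [Module ℝ V]

/-- Carathéodory's theorem for cones: a nonnegative combination can be rewritten with at most
`finrank` many nonzero coefficients. -/
theorem exists_nonneg_combination_card_le [FiniteDimensional ℝ V] (R : ι → V) (c : ι → ℝ)
    (hc : ∀ i, 0 ≤ c i) :
    ∃ (d : ι → ℝ) (s : Finset ι), (∀ i, 0 ≤ d i) ∧ (∀ i ∉ s, d i = 0) ∧
      s.card ≤ Module.finrank ℝ V ∧ ∑ i, d i • R i = ∑ i, c i • R i := by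
  induction hN : (Finset.univ.filter fun i => c i ≠ 0).card using Nat.strong_induction_on
    generalizing c with
  | _ N ih =>
  subst hN
  set s := Finset.univ.filter fun i => c i ≠ 0 with hs
  by_cases hle : s.card ≤ Module.finrank ℝ V
  · exact ⟨c, s, hc, fun i hi => by simpa [hs] using hi, hle, rfl⟩
  have hdep : ¬ LinearIndependent ℝ fun i : s => R i := fun h => hle (by
    simpa using h.fintype_card_le_finrank)
  obtain ⟨g, hg, i₁, hi₁⟩ := Fintype.not_linearIndependent_iff.1 hdep
  obtain ⟨g, hg, hgs, i₁, hi₁⟩ : ∃ g : ι → ℝ, ∑ i, g i • R i = 0 ∧ (∀ i ∉ s, g i = 0) ∧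
      ∃ i, 0 < g i := by
    let G : ι → ℝ := fun i => if h : i ∈ s then g ⟨i, h⟩ else 0
    have hG : ∀ i : s, G i = g i := fun i => dif_pos i.2
    have hG0 : ∀ i ∉ s, G i = 0 := fun i hi => dif_neg hi
    have hGs : ∑ i, G i • R i = 0 := by
      rw [← hg, ← Finset.sum_subset (Finset.subset_univ s) (fun i _ hi => by rw [hG0 i hi, zero_smul]),
        ← Finset.sum_coe_sort s]
      simp only [hG]
    rcases lt_or_gt_of_ne hi₁ with h | h
    · refine ⟨fun i => - G i, by simpa using hGs, fun i hi => by simp [hG0 i hi], i₁, ?_⟩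
      simpa [hG] using h
    · exact ⟨G, hGs, hG0, i₁, by simpa [hG] using h⟩
  -- Move along the relation `g` until the first coefficient, that of i₀, vanishes.
  obtain ⟨i₀, hi₀, hmin⟩ := (Finset.univ.filter fun i => 0 < g i).exists_min_image
    (fun i => c i / g i) ⟨i₁, by simpa using hi₁⟩
  simp only [Finset.mem_filter, Finset.mem_univ, true_and] at hi₀ hmin
  let t := c i₀ / g i₀
  have ht : 0 ≤ t := div_nonneg (hc _) hi₀.le
  let c' : ι → ℝ := fun i => c i - t * g i
  have hc' : ∀ i, 0 ≤ c' i := by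
    intro i
    rcases le_or_gt (g i) 0 with h | h
    · have := mul_nonneg ht (neg_nonneg.2 h)
      simp only [c']
      linarith [hc i]
    · have := (le_div_iff₀ h).1 (hmin i h)
      simp only [c', t]
      linarith
  have hsum : ∑ i, c' i • R i = ∑ i, c i • R i := by
    simp only [c', sub_smul, mul_smul, Finset.sum_sub_distrib, ← Finset.smul_sum, hg, smul_zero,
      sub_zero]
  have hlt : (Finset.univ.filter fun i => c' i ≠ 0).card < s.card := by
    apply Finset.card_lt_card
    refine Finset.ssubset_iff_subset_ne.2 ⟨fun i hi => ?_, fun h => ?_⟩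
    · by_contra his
      have h1 : c i = 0 := by simpa [hs] using his
      simp [c', h1, hgs i his] at hi
    · have : i₀ ∈ s := by
        by_contra his
        rw [hgs i₀ his] at hi₀
        exact lt_irrefl _ hi₀
      rw [← h] at this
      simp [c', t, div_mul_cancel₀ _ hi₀.ne'] at this
  obtain ⟨d, s', h1, h2, h3, h4⟩ := ih _ hlt c' hc' rfl
  exact ⟨d, s', h1, h2, h3, h4.trans hsum⟩

end ConicCaratheodory

/-! ### Extreme points of polytopes. -/

section Polytope

variable {V : Type*} [NormedAddCommGroup V] [NormedSpace ℝ V]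

/-- An extreme point of a polytope is strictly separated from the remaining points. -/
theorem exists_lt_of_mem_extremePoints_convexHull (S : Finset V) {w : V}
    (hw : w ∈ (convexHull ℝ (S : Set V)).extremePoints ℝ) :
    ∃ l : StrongDual ℝ V, ∀ x ∈ convexHull ℝ (S : Set V), x ≠ w → l x < l w := by
  classical
  have hwS : w ∈ S := extremePoints_convexHull_subset hw
  have hnot : w ∉ convexHull ℝ ((S.erase w : Finset V) : Set V) := by
    intro h
    have h1 := convex_convexHull ℝ (S : Set V)
    have h2 := (h1.mem_extremePoints_iff_mem_sdiff_convexHull_sdiff.1 hw).2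
    apply h2
    refine convexHull_mono ?_ h
    intro x hx
    have hx' := Finset.mem_erase.1 (Finset.mem_coe.1 hx)
    exact ⟨subset_convexHull ℝ _ hx'.2, hx'.1⟩
  obtain ⟨l, u, h1, h2⟩ := geometric_hahn_banach_closed_point (convex_convexHull ℝ _)
    ((S.erase w).finite_toSet.isCompact_convexHull ℝ).isClosed hnot
  refine ⟨l, fun x hx hxw => ?_⟩
  rcases (S.erase w).eq_empty_or_nonempty with he | hne
  · have : (S : Set V) = {w} := by
      rw [← Finset.insert_erase hwS, he]
      simp
    rw [this, convexHull_singleton] at hx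
    exact absurd hx hxw
  · rw [← Finset.insert_erase hwS, Finset.coe_insert,
      convexHull_insert (by exact_mod_cast hne), mem_convexJoin] at hx
    obtain ⟨a, ha, y, hy, α, β, hα, hβ, hαβ, rfl⟩ := hx
    rw [mem_singleton_iff.1 ha] at hxw ⊢
    have hly : l y < l w := (h1 y hy).trans h2
    have hβ0 : 0 < β := by
      refine lt_of_le_of_ne hβ fun h => hxw ?_
      rw [← h] at hαβ ⊢
      rw [add_zero] at hαβ
      simp [hαβ]
    simp only [map_add, map_smul, smul_eq_mul]
    have : α = 1 - β := by linarith
    subst this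
    nlinarith

theorem convexHull_extremePoints_convexHull (S : Finset V) :
    convexHull ℝ ((convexHull ℝ (S : Set V)).extremePoints ℝ) = convexHull ℝ (S : Set V) := by
  have hfin : ((convexHull ℝ (S : Set V)).extremePoints ℝ).Finite :=
    S.finite_toSet.subset extremePoints_convexHull_subset
  rw [← (hfin.isCompact_convexHull ℝ).isClosed.closure_eq]
  exact closure_convexHull_extremePoints (S.finite_toSet.isCompact_convexHull ℝ)
    (convex_convexHull ℝ _)

end Polytope

/-! ### Finitely generated cones. -/

section NonnegCone

variable {ι V : Type*} [Fintype ι] [AddCommGroup V] [Module ℝ V]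

/-- The cone of nonnegative combinations of a finite family. -/
def nonnegCone (R : ι → V) : Set V := {y | ∃ c : ι → ℝ, (∀ i, 0 ≤ c i) ∧ ∑ i, c i • R i = y}

theorem zero_mem_nonnegCone (R : ι → V) : (0 : V) ∈ nonnegCone R := ⟨0, by simp, by simp⟩

theorem add_mem_nonnegCone {R : ι → V} {x y : V} (hx : x ∈ nonnegCone R) (hy : y ∈ nonnegCone R) :
    x + y ∈ nonnegCone R := by
  obtain ⟨c, hc, rfl⟩ := hx
  obtain ⟨d, hd, rfl⟩ := hy
  exact ⟨c + d, fun i => add_nonneg (hc i) (hd i), by simp [add_smul, Finset.sum_add_distrib]⟩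

theorem smul_mem_nonnegCone {R : ι → V} {x : V} {a : ℝ} (ha : 0 ≤ a) (hx : x ∈ nonnegCone R) :
    a • x ∈ nonnegCone R := by
  obtain ⟨c, hc, rfl⟩ := hx
  exact ⟨fun i => a * c i, fun i => mul_nonneg ha (hc i), by simp [mul_smul, Finset.smul_sum]⟩

theorem mem_nonnegCone_self (R : ι → V) (i : ι) : R i ∈ nonnegCone R := by
  classical
  exact ⟨Pi.single i 1, fun j => by by_cases h : j = i <;> simp [h], by
    simp [Pi.single_apply]⟩

theorem convex_nonnegCone (R : ι → V) : Convex ℝ (nonnegCone R) :=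
  fun _ hx _ hy _ _ ha hb _ =>
    add_mem_nonnegCone (smul_mem_nonnegCone ha hx) (smul_mem_nonnegCone hb hy)

end NonnegCone

/-! ### Vertices and tangent cones of generalized polyhedra. -/

section Polyhedron

variable {n : ℕ} {P : Set (Fin n → ℝ)} {v : Fin n → ℝ}

/-- Intersecting with a simplex around the point reduces local questions to polytopes, even when `P`
is unbounded. -/
theorem IsConvexPolyhedron.exists_local_polytope (hP : IsConvexPolyhedron P) (w : Fin n → ℝ) :
    ∃ S : Finset (Fin n → ℝ), convexHull ℝ (S : Set (Fin n → ℝ)) ⊆ P ∧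
      ∃ U ∈ 𝓝 w, P ∩ U ⊆ convexHull ℝ (S : Set (Fin n → ℝ)) := by
  classical
  obtain ⟨b, hb, -⟩ := exists_mem_interior_convexHull_affineBasis (x := w) Filter.univ_mem
  obtain ⟨S, hS⟩ := hP.2 (Finset.univ.image b)
  refine ⟨S, hS ▸ inter_subset_left, _, mem_interior_iff_mem_nhds.1 hb, ?_⟩
  rw [← hS]
  simp

theorem IsVertexOf.mem (hv : IsVertexOf P v) : v ∈ P :=
  (hv.2.1.subset) rfl

theorem IsVertexOf.exists_functional (hv : IsVertexOf P v) :
    ∃ l : StrongDual ℝ (Fin n → ℝ), ∀ x ∈ P, x ≠ v → l x < l v := by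
  obtain ⟨l, hl⟩ := hv.2.1 ⟨v, rfl⟩
  have hvl : v ∈ {x | x ∈ P ∧ ∀ y ∈ P, l y ≤ l x} := hl ▸ rfl
  refine ⟨l, fun x hx hxv => lt_of_le_of_ne (hvl.2 x hx) fun h => hxv ?_⟩
  have : x ∈ ({v} : Set _) := hl ▸ ⟨hx, fun y hy => h ▸ hvl.2 y hy⟩
  exact this

theorem exists_smul_sub_add_mem {U : Set (Fin n → ℝ)} (hU : U ∈ 𝓝 v) (x : Fin n → ℝ) :
    ∃ t : ℝ, 0 < t ∧ t ≤ 1 ∧ v + t • x ∈ U := by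
  have hc : Filter.Tendsto (fun t : ℝ => v + t • x) (𝓝[>] 0) (𝓝 v) := by
    have : Continuous fun t : ℝ => v + t • x := by fun_prop
    simpa using (this.tendsto 0).mono_left nhdsWithin_le_nhds
  have h1 := hc.eventually hU
  have h2 : ∀ᶠ t : ℝ in 𝓝[>] 0, t ∈ Ioc (0 : ℝ) 1 := Ioc_mem_nhdsGT one_pos
  obtain ⟨t, ht, ht'⟩ := (h1.and h2).exists
  exact ⟨t, ht'.1, ht'.2, ht⟩

theorem Convex.add_smul_mem_of_le (hP : Convex ℝ P) {x : Fin n → ℝ} (hv : v ∈ P) {a b : ℝ}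
    (ha : 0 ≤ a) (hab : a ≤ b) (hx : v + b • x ∈ P) : v + a • x ∈ P := by
  rcases eq_or_lt_of_le (ha.trans hab) with h | h
  · rw [← h] at hab
    have : a = 0 := le_antisymm hab ha
    simpa [this] using hv
  have h1 := hP.add_smul_mem hv hx (t := a / b) ⟨div_nonneg ha h.le, (div_le_one h).2 hab⟩
  rwa [smul_smul, div_mul_cancel₀ _ h.ne'] at h1

/-- Extreme points of a generalized polyhedron are vertices. -/
theorem IsConvexPolyhedron.isVertexOf_of_extreme (hP : IsConvexPolyhedron P) {w : Fin n → ℝ}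
    (hw : w ∈ P.extremePoints ℝ) : IsVertexOf P w := by
  obtain ⟨S, hSP, U, hU, hUS⟩ := hP.exists_local_polytope w
  have hwS : w ∈ (convexHull ℝ (S : Set (Fin n → ℝ))).extremePoints ℝ :=
    inter_extremePoints_subset_extremePoints_of_subset hSP
      ⟨hUS ⟨hw.1, mem_of_mem_nhds hU⟩, hw⟩
  obtain ⟨l, hl⟩ := exists_lt_of_mem_extremePoints_convexHull S hwS
  -- By convexity a strict local maximum of a linear functional is global: shrink the segment
  -- towards x until it lies in the local polytope.
  have hl' : ∀ x ∈ P, x ≠ w → l x < l w := by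
    intro x hx hxw
    obtain ⟨t, ht0, ht1, ht⟩ := exists_smul_sub_add_mem hU (x - w)
    have h1 : w + t • (x - w) ∈ P := hP.1.add_smul_sub_mem hw.1 hx ⟨ht0.le, ht1⟩
    have h2 := hl _ (hUS ⟨h1, ht⟩) fun h => by
      have : t • (x - w) = 0 := by simpa using h
      rcases smul_eq_zero.1 this with h | h
      · exact ht0.ne' h
      · exact hxw (sub_eq_zero.1 h)
    simp only [map_add, map_smul, map_sub, smul_eq_mul] at h2
    by_contra! hcon
    nlinarith
  refine ⟨singleton_nonempty w, fun _ => ⟨l, ?_⟩, by simp [affDim]⟩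
  ext x
  constructor
  · rintro rfl
    refine ⟨hw.1, fun y hy => ?_⟩
    by_cases h : y = x
    · rw [h]
    · exact (hl' y hy h).le
  · rintro ⟨hx, hx'⟩
    by_contra h
    exact absurd (hl' x hx h) (not_lt.2 (hx' w hw.1))

/-- The vertex figure of a generalized polyhedron is a polytope. -/
theorem IsVertexOf.exists_vertex_figure (hP : IsConvexPolyhedron P) (hv : IsVertexOf P v)
    (l : StrongDual ℝ (Fin n → ℝ)) (hl : ∀ x ∈ P, x ≠ v → 0 < l (x - v)) :
    ∃ S : Finset (Fin n → ℝ), (∀ s ∈ S, ∃ x ∈ P, x ≠ v ∧ s = (l (x - v))⁻¹ • (x - v)) ∧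
      ∀ x ∈ P, x ≠ v → (l (x - v))⁻¹ • (x - v) ∈ convexHull ℝ (S : Set (Fin n → ℝ)) := by
  classical
  obtain ⟨S, hSP, U, hU, hUS⟩ := hP.exists_local_polytope v
  have hSP' : ∀ s ∈ S, s ∈ P := fun s hs => hSP (subset_convexHull ℝ _ hs)
  -- Central projection from `v` to the hyperplane where `l` is 1, with `v` as origin. It sends
  -- convex combinations to convex combinations, with weights rescaled by l (s - v).
  let p : (Fin n → ℝ) → Fin n → ℝ := fun x => (l (x - v))⁻¹ • (x - v)
  have hloc : ∀ x ∈ convexHull ℝ (S : Set (Fin n → ℝ)), x ≠ v →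
      p x ∈ convexHull ℝ (((S.erase v).image p : Finset _) : Set (Fin n → ℝ)) := by
    intro x hx hxv
    obtain ⟨w, hw0, hw1, hwx⟩ := Finset.mem_convexHull'.1 hx
    have hpos : ∀ s ∈ S.erase v, 0 < l (s - v) := fun s hs =>
      hl s (hSP' s (Finset.mem_of_mem_erase hs)) (Finset.ne_of_mem_erase hs)
    have h1 : x - v = ∑ s ∈ S.erase v, (w s * l (s - v)) • p s := by
      have h2 : x - v = ∑ s ∈ S, w s • (s - v) := by
        simp only [smul_sub, Finset.sum_sub_distrib, hwx, ← Finset.sum_smul, hw1, one_smul]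
      rw [h2, ← Finset.sum_subset (Finset.erase_subset v S)]
      · refine Finset.sum_congr rfl fun s hs => ?_
        simp only [p]
        rw [smul_smul, mul_assoc, mul_inv_cancel₀ (hpos s hs).ne', mul_one]
      · intro s hs hs'
        have : s = v := by
          by_contra h
          exact hs' (Finset.mem_erase.2 ⟨h, hs⟩)
        simp [this]
    have hlp : ∀ s ∈ S.erase v, l (p s) = 1 := fun s hs => by
      simp only [p, map_smul, smul_eq_mul]
      exact inv_mul_cancel₀ (hpos s hs).ne'
    have hlx : l (x - v) = ∑ s ∈ S.erase v, w s * l (s - v) := by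
      conv_lhs => rw [h1]
      rw [map_sum]
      refine Finset.sum_congr rfl fun s hs => ?_
      rw [map_smul, hlp s hs, smul_eq_mul, mul_one]
    have h3 : p x = (S.erase v).centerMass (fun s => w s * l (s - v)) p := by
      rw [Finset.centerMass, ← hlx, ← h1]
    rw [h3]
    apply Finset.centerMass_mem_convexHull
    · exact fun s hs => mul_nonneg (hw0 s (Finset.mem_of_mem_erase hs)) (hpos s hs).le
    · rw [← hlx]
      exact hl x (hSP hx) hxv
    · exact fun s hs => Finset.mem_coe.2 (Finset.mem_image_of_mem p hs)
  refine ⟨(S.erase v).image p, fun s hs => ?_, fun x hx hxv => ?_⟩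
  · obtain ⟨x, hx, rfl⟩ := Finset.mem_image.1 hs
    exact ⟨x, hSP' x (Finset.mem_of_mem_erase hx), Finset.ne_of_mem_erase hx, rfl⟩
  -- Contracting towards `v` does not change the projection, so the local statement suffices.
  · obtain ⟨t, ht0, ht1, ht⟩ := exists_smul_sub_add_mem hU (x - v)
    have h1 : v + t • (x - v) ∈ P := hP.1.add_smul_sub_mem hv.mem hx ⟨ht0.le, ht1⟩
    have h2 := hloc _ (hUS ⟨h1, ht⟩) fun h => by
      have : t • (x - v) = 0 := by simpa using h
      rcases smul_eq_zero.1 this with h | h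
      · exact ht0.ne' h
      · exact hxv (sub_eq_zero.1 h)
    simp only [p, add_sub_cancel_left, map_smul, smul_eq_mul, mul_inv, smul_smul] at h2
    rwa [mul_right_comm, inv_mul_cancel₀ ht0.ne', one_mul] at h2

/-- A generalized polyhedron lies in the cone at a vertex spanned by the edges. -/
theorem IsVertexOf.sub_mem_nonnegCone {ι : Type*} [Fintype ι] (hP : IsConvexPolyhedron P)
    (hv : IsVertexOf P v) (R : ι → Fin n → ℝ)
    (hR : ∀ E ∈ edgesAt P v, ∀ x ∈ E, x - v ∈ nonnegCone R) :
    ∀ x ∈ P, x - v ∈ nonnegCone R := by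
  obtain ⟨l₀, hl₀⟩ := hv.exists_functional
  obtain ⟨l, hl⟩ : ∃ l : StrongDual ℝ (Fin n → ℝ), ∀ x ∈ P, x ≠ v → 0 < l (x - v) :=
    ⟨-l₀, fun x hx hxv => by simpa using hl₀ x hx hxv⟩
  obtain ⟨S, hS, hSP⟩ := hv.exists_vertex_figure hP l hl
  have hlS : ∀ x ∈ P, x ≠ v → x - v = l (x - v) • ((l (x - v))⁻¹ • (x - v)) :=
    fun x hx hxv => by rw [smul_smul, mul_inv_cancel₀ (hl x hx hxv).ne', one_smul]
  have hext : (convexHull ℝ (S : Set (Fin n → ℝ))).extremePoints ℝ ⊆ nonnegCone R := by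
    intro e he
    obtain ⟨g, hg⟩ := exists_lt_of_mem_extremePoints_convexHull S he
    obtain ⟨s, hsP, hsv, hes⟩ := hS e (extremePoints_convexHull_subset he)
    have hle : l e = 1 := by
      rw [hes, map_smul, smul_eq_mul, inv_mul_cancel₀ (hl s hsP hsv).ne']
    -- Since `g` peaks on the vertex figure only at `e`, this functional vanishes on `e` and is
    -- negative on all other directions into `P`. It therefore exposes exactly an edge at `v` with
    -- direction `e`.
    let h : StrongDual ℝ (Fin n → ℝ) := g - g e • l
    have hh : ∀ x ∈ P, x ≠ v → h x - h v =
        l (x - v) * (g ((l (x - v))⁻¹ • (x - v)) - g e) := by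
      intro x hx hxv
      have h1 : g (x - v) = l (x - v) * g ((l (x - v))⁻¹ • (x - v)) := by
        conv_lhs => rw [hlS x hx hxv]
        rw [map_smul, smul_eq_mul]
      rw [← map_sub]
      change g (x - v) - g e * l (x - v) = _
      rw [h1]
      ring
    have hle0 : ∀ x ∈ P, h x ≤ h v := by
      intro x hx
      by_cases hxv : x = v
      · rw [hxv]
      have h1 := hh x hx hxv
      have h2 : g ((l (x - v))⁻¹ • (x - v)) ≤ g e := by
        by_cases h3 : (l (x - v))⁻¹ • (x - v) = e
        · rw [h3]
        · exact (hg _ (hSP x hx hxv) h3).le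
      nlinarith [hl x hx hxv]
    have heq : ∀ x ∈ P, h x = h v → x - v = l (x - v) • e := by
      intro x hx hxh
      by_cases hxv : x = v
      · simp [hxv]
      have h1 := hh x hx hxv
      rw [hxh, sub_self, eq_comm, mul_eq_zero] at h1
      have h2 : (l (x - v))⁻¹ • (x - v) = e := by
        by_contra h3
        have h4 := hg _ (hSP x hx hxv) h3
        rcases h1 with h1 | h1
        · exact (hl x hx hxv).ne' h1
        · linarith
      conv_lhs => rw [hlS x hx hxv, h2]
    have hhs : h s = h v := by
      have := hh s hsP hsv
      rw [← hes, sub_self, mul_zero] at this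
      linarith
    let E : Set (Fin n → ℝ) := {x | x ∈ P ∧ ∀ y ∈ P, h y ≤ h x}
    have hvE : v ∈ E := ⟨hv.mem, hle0⟩
    have hsE : s ∈ E := ⟨hsP, fun y hy => hhs ▸ hle0 y hy⟩
    have hspan : vectorSpan ℝ E = Submodule.span ℝ {e} := by
      rw [vectorSpan_eq_span_vsub_set_right ℝ hvE]
      apply le_antisymm
      · rw [Submodule.span_le]
        rintro _ ⟨x, hx, rfl⟩
        have h1 := heq x hx.1 (le_antisymm (hle0 x hx.1) (hx.2 v hv.mem))
        change x - v ∈ Submodule.span ℝ {e}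
        rw [h1]
        exact Submodule.smul_mem _ _ (Submodule.mem_span_singleton_self e)
      · rw [Submodule.span_singleton_le_iff_mem, hes]
        exact Submodule.smul_mem _ _ (Submodule.subset_span ⟨s, hsE, rfl⟩)
    have he0 : e ≠ 0 := by
      rintro rfl
      simp at hle
    have hE : E ∈ edgesAt P v :=
      ⟨⟨⟨v, hvE⟩, fun _ => ⟨h, rfl⟩, by rw [affDim, hspan, finrank_span_singleton he0]⟩, hvE⟩
    rw [hes]
    exact smul_mem_nonnegCone (inv_nonneg.2 (hl s hsP hsv).le) (hR E hE s hsE)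
  have hQ : convexHull ℝ (S : Set (Fin n → ℝ)) ⊆ nonnegCone R := by
    rw [← convexHull_extremePoints_convexHull]
    exact convexHull_min hext (convex_nonnegCone R)
  intro x hx
  by_cases hxv : x = v
  · rw [hxv, sub_self]
    exact zero_mem_nonnegCone R
  · rw [hlS x hx hxv]
    exact smul_mem_nonnegCone (hl x hx hxv).le (hQ (hSP x hx hxv))

end Polyhedron

/-! ### Lattice directions of edges. -/

section Edges

variable {n : ℕ} {P : Set (Fin n → ℝ)} {v : Fin n → ℝ}

theorem intPt_sub (a b : Fin n → ℤ) : intPt (a - b) = intPt a - intPt b := by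
  ext i; simp [intPt]

theorem intPt_zsmul (c : ℤ) (a : Fin n → ℤ) : intPt (c • a) = (c : ℝ) • intPt a := by
  ext i; simp [intPt]

theorem intPt_neg (a : Fin n → ℤ) : intPt (-a) = -intPt a := by
  ext i; simp [intPt]

theorem intPt_sum {ι : Type*} (s : Finset ι) (a : ι → Fin n → ℤ) :
    intPt (∑ i ∈ s, a i) = ∑ i ∈ s, intPt (a i) := by
  ext j; simp [intPt]

theorem IsPrimitiveVec.ne_zero {r : Fin n → ℤ} (hr : IsPrimitiveVec r) : intPt r ≠ 0 := by
  intro h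
  have h0 : ∀ i, r i = 0 := fun i => by
    have := congrFun h i
    simpa [intPt] using this
  have h1 : Finset.univ.gcd r = 0 := Finset.gcd_eq_zero_iff.2 fun i _ => h0 i
  rw [IsPrimitiveVec, h1] at hr
  exact zero_ne_one hr

/-- Pair both sides with Bézout coefficients of the primitive vector. -/
theorem IsPrimitiveVec.exists_int_eq {r z : Fin n → ℤ} (hr : IsPrimitiveVec r) {t : ℝ}
    (h : intPt z = t • intPt r) : ∃ k : ℤ, t = k := by
  obtain ⟨f, hf⟩ := Finset.gcd_eq_sum_mul Finset.univ r
  rw [IsPrimitiveVec] at hr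
  rw [hr] at hf
  refine ⟨∑ i, z i * f i, ?_⟩
  have h1 : (1 : ℝ) = ∑ i, (r i : ℝ) * f i := by exact_mod_cast hf
  have h2 : ∀ i, (z i : ℝ) = t * r i := fun i => by simpa [intPt] using congrFun h i
  push_cast
  calc t = t * 1 := (mul_one t).symm
    _ = ∑ i, (z i : ℝ) * f i := by
        rw [h1, Finset.mul_sum]
        exact Finset.sum_congr rfl fun i _ => by rw [h2 i]; ring

theorem IsVertexOf.not_two_sided (hv : IsVertexOf P v) {x : Fin n → ℝ} (hx : x ≠ 0) {a b : ℝ}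
    (ha : 0 < a) (hb : 0 < b) (h1 : v + a • x ∈ P) (h2 : v - b • x ∈ P) : False := by
  obtain ⟨l, hl⟩ := hv.exists_functional
  have h3 := hl _ h1 (by simpa using ⟨ha.ne', hx⟩)
  have h4 := hl _ h2 (by simpa using ⟨hb.ne', hx⟩)
  simp only [map_add, map_sub, map_smul, smul_eq_mul] at h3 h4
  have h5 : l x < 0 := by nlinarith
  nlinarith

/-- A polyhedron with integer vertices, if it contains `v + t • r` with `r` a primitive direction
of an edge, contains `v + r`. -/
theorem IsVertexOf.add_primitive_mem (hP : IsIntegerConvexPolyhedron P) (hv : IsVertexOf P v)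
    {E : Set (Fin n → ℝ)} (hE : IsExposed ℝ P E)
    {r : Fin n → ℤ} (hr : IsPrimitiveVec r)
    (hEr : ∀ t : ℝ, v + t • intPt r ∈ P → v + t • intPt r ∈ E)
    (hEr' : ∀ x ∈ E, ∃ t : ℝ, x = v + t • intPt r) {t : ℝ} (ht : 0 < t)
    (hmem : v + t • intPt r ∈ P) : v + intPt r ∈ P := by
  by_contra hnot
  have hlt1 : ∀ a : ℝ, v + a • intPt r ∈ P → a < 1 := by
    intro a ha
    by_contra! h
    exact hnot (by simpa using hP.1.1.add_smul_mem_of_le hv.mem zero_le_one h ha)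
  -- the points of the edge up to `v + r`
  let J : Set ℝ := {a | v + a • intPt r ∈ P} ∩ Icc 0 1
  have hJ : IsCompact J := by
    classical
    obtain ⟨S, hS⟩ := hP.1.2 {v, v + intPt r}
    have hJS : J = (fun a : ℝ => v + a • intPt r) ⁻¹' (convexHull ℝ (S : Set (Fin n → ℝ))) ∩
        Icc 0 1 := by
      rw [← hS]
      ext a
      simp only [J, mem_inter_iff, mem_ofPred_eq, mem_preimage]
      constructor
      · rintro ⟨h1, h2⟩
        refine ⟨⟨h1, ?_⟩, h2⟩
        rw [Finset.coe_insert, Finset.coe_singleton, convexHull_pair, segment_eq_image']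
        exact ⟨a, h2, by simp⟩
      · rintro ⟨⟨h1, -⟩, h2⟩
        exact ⟨h1, h2⟩
    rw [hJS]
    refine IsCompact.inter_left isCompact_Icc ?_
    exact (S.finite_toSet.isCompact_convexHull ℝ).isClosed.preimage (by fun_prop)
  obtain ⟨a, haJ, hmax⟩ := hJ.exists_isMaxOn ⟨t, hmem, ht.le, (hlt1 t hmem).le⟩ continuousOn_id
  have hmax' : ∀ b : ℝ, v + b • intPt r ∈ P → b ≤ a := by
    intro b hb
    rcases le_or_gt b 0 with h | h
    · exact h.trans haJ.2.1
    · exact hmax ⟨hb, h.le, (hlt1 b hb).le⟩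
  have ha0 : 0 < a := ht.trans_le (hmax' t hmem)
  have ha1 : a < 1 := hlt1 a haJ.1
  -- The edge is an extreme subset, so a segment of `P` through its far end lies in the edge, and
  -- there the parameter cannot exceed a.
  have hext : v + a • intPt r ∈ P.extremePoints ℝ := by
    refine mem_extremePoints.2 ⟨haJ.1, fun x₁ h₁ x₂ h₂ hseg => ?_⟩
    have hEext := hE.isExtreme
    have h1E := hEext.left_mem_of_mem_openSegment h₁ h₂ (hEr a haJ.1) hseg
    have h2E := hEext.right_mem_of_mem_openSegment h₁ h₂ (hEr a haJ.1) hseg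
    obtain ⟨t₁, rfl⟩ := hEr' x₁ h1E
    obtain ⟨t₂, rfl⟩ := hEr' x₂ h2E
    obtain ⟨α, β, hα, hβ, hαβ, he⟩ := hseg
    have h3 : (α * t₁ + β * t₂ - a) • intPt r = 0 := by
      have h4 : α • (v + t₁ • intPt r) + β • (v + t₂ • intPt r) =
          (α + β) • v + (α * t₁ + β * t₂) • intPt r := by module
      rw [h4, hαβ, one_smul] at he
      rw [sub_smul, add_left_cancel he, sub_self]
    have h5 : α * t₁ + β * t₂ = a :=
      sub_eq_zero.1 ((smul_eq_zero.1 h3).resolve_right hr.ne_zero)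
    have h6 := hmax' t₁ h₁
    have h7 := hmax' t₂ h₂
    have hβ' : β = 1 - α := by linarith
    subst hβ'
    have h8 : t₁ = a := by nlinarith
    have h9 : t₂ = a := by nlinarith
    rw [h8, h9]
    exact ⟨rfl, rfl⟩
  obtain ⟨z, hz⟩ := hP.2 _ (hP.1.isVertexOf_of_extreme hext)
  obtain ⟨z₀, hz₀⟩ := hP.2 _ hv
  obtain ⟨k, hk⟩ := hr.exists_int_eq (z := z - z₀) (t := a) (by
    rw [intPt_sub, hz, hz₀, add_sub_cancel_left])
  rw [hk] at ha0 ha1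
  have h1 : 0 < k := by exact_mod_cast ha0
  have h2 : k < 1 := by exact_mod_cast ha1
  omega

/-- At a vertex of an integer polyhedron, one of the two primitive vectors parallel to an edge
leads from the vertex along the edge, without leaving the polyhedron. -/
theorem IsVertexOf.exists_signed_direction (hP : IsIntegerConvexPolyhedron P)
    (hv : IsVertexOf P v) {E : Set (Fin n → ℝ)} (hE : E ∈ edgesAt P v) {r : Fin n → ℤ}
    (hr : IsPrimitiveDirection E r) :
    ∃ σ : ℤ, (σ = 1 ∨ σ = -1) ∧ v + intPt (σ • r) ∈ P ∧
      ∀ x ∈ E, ∃ c : ℝ, 0 ≤ c ∧ x - v = c • intPt (σ • r) := by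
  obtain ⟨⟨hEne, hEexp, hEdim⟩, hvE⟩ := hE
  obtain ⟨hprim, hdir⟩ := hr
  have hr0 := hprim.ne_zero
  have hspan : vectorSpan ℝ E = Submodule.span ℝ {intPt r} := by
    symm
    apply Submodule.eq_of_le_of_finrank_eq
    · rwa [Submodule.span_singleton_le_iff_mem]
    · rw [finrank_span_singleton hr0]
      exact hEdim.symm
  have hEr' : ∀ x ∈ E, ∃ t : ℝ, x = v + t • intPt r := by
    intro x hx
    have h1 : x - v ∈ vectorSpan ℝ E := vsub_mem_vectorSpan ℝ hx hvE
    rw [hspan, Submodule.mem_span_singleton] at h1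
    obtain ⟨t, ht⟩ := h1
    exact ⟨t, by rw [ht]; abel⟩
  obtain ⟨l, hl⟩ := hEexp ⟨v, hvE⟩
  have hEmem : ∀ x ∈ E, x ∈ P := hEexp.subset
  obtain ⟨x₀, hx₀, hx₀v⟩ : ∃ x ∈ E, x ≠ v := by
    by_contra! hcon
    have : E = {v} := subset_antisymm (fun x hx => hcon x hx) (by simpa using hvE)
    rw [affDim, this, vectorSpan_singleton, finrank_bot] at hEdim
    omega
  have hlr : l (intPt r) = 0 := by
    obtain ⟨t, rfl⟩ := hEr' x₀ hx₀
    have h1 := (hl ▸ hx₀ : _ ∈ {x | x ∈ P ∧ ∀ y ∈ P, l y ≤ l x}).2 v (hEmem v hvE)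
    have h2 := (hl ▸ hvE : v ∈ {x | x ∈ P ∧ ∀ y ∈ P, l y ≤ l x}).2 _ (hEmem _ hx₀)
    have h3 : t * l (intPt r) = 0 := by
      simp only [map_add, map_smul, smul_eq_mul] at h1 h2
      linarith
    refine (mul_eq_zero.1 h3).resolve_left fun h => hx₀v ?_
    simp [h]
  have hEr : ∀ t : ℝ, v + t • intPt r ∈ P → v + t • intPt r ∈ E := by
    intro t ht
    have h2 := (hl ▸ hvE : v ∈ {x | x ∈ P ∧ ∀ y ∈ P, l y ≤ l x}).2
    rw [hl]
    refine ⟨ht, fun y hy => ?_⟩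
    simpa [hlr] using h2 y hy
  obtain ⟨t, rfl⟩ := hEr' x₀ hx₀
  have ht0 : t ≠ 0 := fun h => hx₀v (by simp [h])
  have hprim' : IsPrimitiveVec (-r) := by
    have h1 : Finset.univ.gcd (-r) = Finset.univ.gcd r :=
      dvd_antisymm_of_normalize_eq Finset.normalize_gcd Finset.normalize_gcd
        (Finset.gcd_mono_fun fun i _ => by simp) (Finset.gcd_mono_fun fun i _ => by simp)
    rwa [IsPrimitiveVec, h1]
  have main : ∃ σ : ℤ, (σ = 1 ∨ σ = -1) ∧ v + intPt (σ • r) ∈ P := by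
    rcases lt_or_gt_of_ne ht0 with h | h
    · refine ⟨-1, Or.inr rfl, ?_⟩
      rw [neg_one_smul]
      have hneg : ∀ a : ℝ, a • intPt (-r) = (-a) • intPt r := fun a => by
        rw [intPt_neg, smul_neg, neg_smul]
      refine hv.add_primitive_mem hP hEexp hprim' (fun a => ?_) (fun x hx => ?_)
        (t := -t) (by linarith) ?_
      · rw [hneg]
        exact hEr _
      · obtain ⟨a, ha⟩ := hEr' x hx
        exact ⟨-a, by rw [hneg, neg_neg, ha]⟩
      · rw [hneg, neg_neg]
        exact hEmem _ hx₀
    · refine ⟨1, Or.inl rfl, ?_⟩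
      rw [one_smul]
      exact hv.add_primitive_mem hP hEexp hprim hEr hEr' h (hEmem _ hx₀)
  obtain ⟨σ, hσ, hσP⟩ := main
  refine ⟨σ, hσ, hσP, fun x hx => ?_⟩
  obtain ⟨a, rfl⟩ := hEr' x hx
  have hσσ : (σ : ℝ) * σ = 1 := by rcases hσ with rfl | rfl <;> norm_num
  have hxa : v + a • intPt r - v = (a * σ) • intPt (σ • r) := by
    rw [intPt_zsmul, smul_smul, mul_assoc, hσσ, mul_one, add_sub_cancel_left]
  refine ⟨a * σ, ?_, hxa⟩
  -- A negative coefficient would make `P` extend from `v` both ways along one line.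
  by_contra! hneg
  have hq : intPt (σ • r) ≠ 0 := by
    rw [intPt_zsmul]
    refine smul_ne_zero ?_ hr0
    rcases hσ with rfl | rfl <;> norm_num
  refine hv.not_two_sided hq one_pos (b := -(a * σ)) (by linarith) (by simpa using hσP) ?_
  have : v - -(a * σ) • intPt (σ • r) = v + a • intPt r := by
    rw [neg_smul, sub_neg_eq_add, ← hxa]
    abel
  rw [this]
  exact hEmem _ hx

end Edges

/-! ### The index of a lattice generated by a level set. -/

section Index

/-- The index of a subgroup containing a full level set of an integer functional. -/
theorem enatCard_quotient_le_natAbs {G : Type*} [AddCommGroup G] (ψ : G →+ ℤ) (z : G)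
    (hz : ψ z ≠ 0) (L : AddSubgroup G) (hL : ∀ w, ψ w = ψ z → w ∈ L) :
    ENat.card (G ⧸ L) ≤ ((ψ z).natAbs : ℕ∞) := by
  have hzL : z ∈ L := hL z rfl
  have hdvd : ∀ w, ψ z ∣ ψ w → w ∈ L := by
    rintro w ⟨c, hc⟩
    -- Translating by a multiple of z brings w to the level of z. So `L` contains the preimage of (ψ
    -- z)ℤ, and cosets are separated by ψ modulo ψ z.
    have h1 : w - c • z + z ∈ L := hL _ (by
      rw [map_add, map_sub, map_zsmul, hc, smul_eq_mul]
      ring)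
    have h2 := L.add_mem (L.sub_mem h1 hzL) (L.zsmul_mem hzL c)
    simpa using h2
  have : NeZero (ψ z).natAbs := ⟨Int.natAbs_ne_zero.2 hz⟩
  have hinj : Function.Injective fun q : G ⧸ L => ((ψ q.out : ℤ) : ZMod (ψ z).natAbs) := by
    intro a b hab
    have h1 : (((ψ b.out - ψ a.out : ℤ)) : ZMod (ψ z).natAbs) = 0 := by
      push_cast
      exact sub_eq_zero.2 hab.symm
    rw [ZMod.intCast_zmod_eq_zero_iff_dvd, Int.natAbs_dvd, ← map_sub] at h1
    have h2 := hdvd _ h1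
    rw [← a.out_eq, ← b.out_eq]
    apply QuotientAddGroup.eq.2
    rwa [neg_add_eq_sub]
  refine (ENat.card_le_card_of_injective hinj).trans ?_
  rw [ENat.card_eq_coe_fintype_card, ZMod.card]

end Index

/-! ### Determinants of the edge star. -/

section EdgeStarDet

variable {n m : ℕ}

/-- Sorting an injective choice of rows changes only the sign and yields one summand; a repeated row
gives zero. -/
theorem natAbs_det_le_edgeStarDet (r : Fin m → Fin n → ℤ) (g : Fin n → Fin m) :
    (Matrix.of fun j => r (g j)).det.natAbs ≤ edgeStarDet r := by
  by_cases hg : Function.Injective g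
  · have hs : (Finset.univ.image g).card = n := by
      rw [Finset.card_image_of_injective _ hg, Finset.card_univ, Fintype.card_fin]
    let e := (Finset.univ.image g).orderIsoOfFin hs
    let τ : Fin n → Fin n := fun j => e.symm ⟨g j, Finset.mem_image_of_mem g (Finset.mem_univ j)⟩
    have hτ : Function.Injective τ := by
      intro a b hab
      have := e.symm.injective hab
      exact hg (congrArg Subtype.val this)
    let σ : Equiv.Perm (Fin n) := Equiv.ofBijective τ (Finite.injective_iff_bijective.1 hτ)
    let i := (Finset.univ.image g).orderEmbOfFin hs
    have hi : ∀ j, g j = i (σ j) := by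
      intro j
      change g j = (e (e.symm _) : Fin m)
      rw [OrderIso.apply_symm_apply]
    have h1 : (Matrix.of fun j => r (g j)) = (Matrix.of fun j => r (i j)).submatrix σ id := by
      ext a b
      simp [hi]
    have h2 : (Matrix.of fun j => r (g j)).det.natAbs = (Matrix.of fun j => r (i j)).det.natAbs := by
      rw [h1, Matrix.det_permute, Int.natAbs_mul]
      rcases Int.units_eq_one_or (Equiv.Perm.sign σ) with h | h <;> simp [h]
    rw [h2]
    exact Finset.single_le_sum (f := fun i : Fin n ↪o Fin m => (Matrix.of fun j => r (i j)).det.natAbs)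
      (fun _ _ => Nat.zero_le _) (Finset.mem_univ i)
  · rw [Function.Injective] at hg
    push Not at hg
    obtain ⟨a, b, hab, hne⟩ := hg
    rw [Matrix.det_zero_of_row_eq hne (by ext c; simp [hab])]
    simp

theorem edgeStarDet_sign_smul (r : Fin m → Fin n → ℤ) (σ : Fin m → ℤ)
    (hσ : ∀ i, σ i = 1 ∨ σ i = -1) : edgeStarDet (fun i => σ i • r i) = edgeStarDet r := by
  refine Finset.sum_congr rfl fun i _ => ?_
  have h1 : (Matrix.of fun j => σ (i j) • r (i j)) =
      Matrix.of fun a b => σ (i a) * (Matrix.of fun j => r (i j)) a b := by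
    ext a b
    simp
  rw [h1, Matrix.det_mul_column, Int.natAbs_mul]
  have h2 : (∏ j, σ (i j)).natAbs = 1 := by
    rw [← Int.isUnit_iff_natAbs_eq]
    refine IsUnit.prod_univ_iff.2 fun j => ?_
    exact Int.isUnit_iff.2 (hσ _)
  rw [h2, one_mul]

/-- For m < n there are no increasing n-tuples, and the sum is empty. -/
theorem le_of_edgeStarDet_pos (r : Fin m → Fin n → ℤ) (h : 0 < edgeStarDet r) : n ≤ m := by
  obtain ⟨i, -, -⟩ := Finset.exists_ne_zero_of_sum_ne_zero h.ne'
  simpa using Fintype.card_le_of_embedding i.toEmbedding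

/-- The cofactor expansion of a determinant in its first row, as a functional with integer
coefficients. -/
theorem exists_det_cons_eq_sum {k : ℕ} (q : Fin k → Fin (k + 1) → ℤ) :
    ∃ a : Fin (k + 1) → ℤ,
      (∀ w : Fin (k + 1) → ℝ, (Matrix.of (Fin.cons w fun j => intPt (q j) :
        Fin (k + 1) → Fin (k + 1) → ℝ)).det = ∑ i, (a i : ℝ) * w i) ∧
      ∀ w : Fin (k + 1) → ℤ, (Matrix.of (Fin.cons w q : Fin (k + 1) → Fin (k + 1) → ℤ)).det =
        ∑ i, a i * w i := by
  let M : Fin (k + 1) → Matrix (Fin k) (Fin k) ℤ := fun i => (Matrix.of q).submatrix id i.succAbove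
  refine ⟨fun i => (-1) ^ (i : ℕ) * (M i).det, fun w => ?_, fun w => ?_⟩
  · rw [Matrix.det_succ_row_zero]
    refine Finset.sum_congr rfl fun i _ => ?_
    have h1 : (Matrix.of (Fin.cons w fun j => intPt (q j) :
        Fin (k + 1) → Fin (k + 1) → ℝ)).submatrix Fin.succ i.succAbove =
        (M i).map (Int.castRingHom ℝ) := by
      ext a b
      simp [M, intPt]
    rw [h1, ← RingHom.mapMatrix_apply, ← RingHom.map_det]
    simp
    ring
  · rw [Matrix.det_succ_row_zero]
    refine Finset.sum_congr rfl fun i _ => ?_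
    have h1 : (Matrix.of (Fin.cons w q : Fin (k + 1) → Fin (k + 1) → ℤ)).submatrix
        Fin.succ i.succAbove = M i := by
      ext a b
      simp [M]
    rw [h1]
    simp
    ring

end EdgeStarDet

/-! ### Consequences of interiority and emptiness. -/

section Main

variable {n m : ℕ} {P : Set (Fin n → ℝ)} {v : Fin n → ℝ}

theorem Convex.exists_smul_of_mem_convexHull_union_zero (hP : Convex ℝ P) (hne : P.Nonempty)
    {y : Fin n → ℝ} (hy : y ∈ convexHull ℝ (P ∪ {0})) :
    ∃ a : ℝ, 0 ≤ a ∧ a ≤ 1 ∧ ∃ x ∈ P, y = a • x := by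
  rw [union_singleton, convexHull_insert hne, hP.convexHull_eq, mem_convexJoin] at hy
  obtain ⟨z, hz, x, hx, α, β, hα, hβ, hαβ, rfl⟩ := hy
  rw [mem_singleton_iff.1 hz]
  exact ⟨β, hβ, by linarith, x, hx, by simp⟩

/-- A vertex interior to the hull with the origin lies in the tangent cone (moved to the origin). -/
theorem mem_nonnegCone_of_mem_interior (hP : Convex ℝ P)
    (hvP : v ∈ P) (hvint : v ∈ interior (convexHull ℝ (P ∪ {0}))) {R : Fin m → Fin n → ℝ}
    (hcone : ∀ x ∈ P, x - v ∈ nonnegCone R) : v ∈ nonnegCone R := by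
  obtain ⟨t, ht0, -, ht⟩ := exists_smul_sub_add_mem (mem_interior_iff_mem_nhds.1 hvint) v
  obtain ⟨a, ha0, ha1, x, hx, he⟩ := hP.exists_smul_of_mem_convexHull_union_zero ⟨v, hvP⟩ ht
  have h1 : 0 < 1 + t - a := by linarith
  have h2 : v = (a / (1 + t - a)) • (x - v) := by
    have h3 : (1 + t - a) • v = a • (x - v) := by
      rw [smul_sub, ← he]
      module
    rw [div_eq_inv_mul, mul_smul, ← h3, smul_smul, inv_mul_cancel₀ h1.ne', one_smul]
  rw [h2]
  exact smul_mem_nonnegCone (div_nonneg ha0 h1.le) (hcone x hx)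

/-- The value at an interior vertex of a functional maximal there over the polyhedron. -/
theorem neg_of_isMax_of_mem_interior (hP : Convex ℝ P)
    (hvP : v ∈ P) (hvint : v ∈ interior (convexHull ℝ (P ∪ {0})))
    {l : StrongDual ℝ (Fin n → ℝ)} (hl0 : l ≠ 0) (hl : ∀ x ∈ P, l x ≤ l v) : l v < 0 := by
  obtain ⟨d, hd⟩ : ∃ d, 0 < l d := by
    by_contra! hcon
    refine hl0 (ContinuousLinearMap.ext fun x => le_antisymm (hcon x) ?_)
    simpa using hcon (-x)
  -- With v + t d = a x and a ≤ 1, one gets l v < l (a x) ≤ a · l v, impossible for l v ≥ 0.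
  obtain ⟨t, ht0, -, ht⟩ := exists_smul_sub_add_mem (mem_interior_iff_mem_nhds.1 hvint) d
  obtain ⟨a, ha0, ha1, x, hx, he⟩ := hP.exists_smul_of_mem_convexHull_union_zero ⟨v, hvP⟩ ht
  have h1 := congrArg l he
  simp only [map_add, map_smul, smul_eq_mul] at h1
  by_contra! hcon
  have h2 := mul_pos ht0 hd
  have h3 := mul_le_mul_of_nonneg_left (hl x hx) ha0
  nlinarith

/-- If the hull of `P` and the origin has no lattice points outside `P` but the origin, then the
coefficients of a vertex with respect to few lattice directions of edges are bounded. -/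
theorem one_add_sum_le_of_empty (hn : 2 ≤ n) (hv : IsVertexOf P v)
    (hvZ : v ∈ intLattice n) (hempty : (intLattice n ∩ convexHull ℝ (P ∪ {0})) \ P = {0})
    (q : Fin m → Fin n → ℤ) (hq : ∀ i, v + intPt (q i) ∈ P) (hq0 : ∀ i, intPt (q i) ≠ 0)
    (d : Fin m → ℝ) (s : Finset (Fin m)) (hd : ∀ i, 0 ≤ d i) (hds : ∀ i ∉ s, d i = 0)
    (hs : s.card ≤ n) (hvd : v = ∑ i, d i • intPt (q i)) :
    1 + ∑ i, d i ≤ ((n ^ (8 * n.factorial) : ℕ) : ℝ) := by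
  by_contra! hbig
  obtain ⟨k, hk1, hk2, hk3⟩ := exists_integer_vector_below n hn s hs d hd hds hbig
  set N : ℕ := ∑ i, k i with hN
  set L : ℝ := 1 + ∑ i, d i with hL
  have hd0 : 0 ≤ ∑ i, d i := Finset.sum_nonneg fun i _ => hd i
  have hL0 : 0 < L := by linarith
  obtain ⟨l, hl⟩ := hv.exists_functional
  have hlq : ∀ i, l (intPt (q i)) < 0 := fun i => by
    have := hl _ (hq i) (by simpa using hq0 i)
    simpa using this
  obtain ⟨z₀, hz₀⟩ := hvZ
  let y : Fin n → ℝ := ∑ i, (k i : ℝ) • intPt (q i)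
  have hly : l y < 0 := by
    simp only [y, map_sum, map_smul, smul_eq_mul]
    obtain ⟨i, -, hi⟩ := Finset.exists_ne_zero_of_sum_ne_zero (by omega : ∑ i, k i ≠ 0)
    refine Finset.sum_neg' (fun i _ => ?_) ⟨i, Finset.mem_univ i, ?_⟩
    · exact mul_nonpos_of_nonneg_of_nonpos (Nat.cast_nonneg _) (hlq i).le
    · exact mul_neg_of_pos_of_neg (by exact_mod_cast Nat.pos_of_ne_zero hi) (hlq i)
  -- Every q i lowers `l`, so subtracting y raises it above its maximum over `P`.
  have hyP : v - y ∉ P := by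
    intro h
    have hne : v - y ≠ v := fun h' => by
      have : y = 0 := by simpa using h'
      rw [this, map_zero] at hly
      exact lt_irrefl _ hly
    have := hl _ h hne
    rw [map_sub] at this
    linarith
  have hyZ : v - y ∈ intLattice n := by
    refine ⟨z₀ - ∑ i, (k i : ℤ) • q i, ?_⟩
    rw [intPt_sub, hz₀, intPt_sum]
    simp only [intPt_zsmul, y, Int.cast_natCast]
  -- the lattice point as a convex combination
  let c : Fin m → ℝ := fun i => (N + 1) / L * d i - k i
  have hc0 : ∀ i, 0 ≤ c i := fun i => by
    have := hk3 i
    simp only [c]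
    rw [sub_nonneg, div_mul_eq_mul_div, le_div_iff₀ hL0]
    exact this
  have hcsum : (N + 1) / L + ∑ i, c i = 1 := by
    simp only [c, Finset.sum_sub_distrib, ← Finset.mul_sum]
    have h1 : ∑ i, (k i : ℝ) = N := by rw [hN]; push_cast; rfl
    have h2 : ∑ i, d i = L - 1 := by rw [hL]; ring
    rw [h1, h2]
    field_simp
    ring
  have hcq : ∑ i, c i • intPt (q i) = ((N + 1) / L) • v - y := by
    simp only [c, sub_smul, Finset.sum_sub_distrib, mul_smul, ← Finset.smul_sum, ← hvd, y]
  have hcomb : v - y = ((N + 1) / L) • (0 : Fin n → ℝ) + ∑ i, c i • (v + intPt (q i)) := by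
    have h2 : ∑ i, c i = 1 - (N + 1) / L := by linarith
    simp only [smul_add, Finset.sum_add_distrib]
    rw [hcq, ← Finset.sum_smul, h2]
    module
  have hyC : v - y ∈ convexHull ℝ (P ∪ {0}) := by
    rw [hcomb]
    let w : Option (Fin m) → ℝ := fun o => o.elim ((N + 1) / L) c
    let p : Option (Fin m) → Fin n → ℝ := fun o => o.elim 0 fun i => v + intPt (q i)
    have h1 : ∑ o, w o • p o ∈ convexHull ℝ (P ∪ {0}) := by
      refine (convex_convexHull ℝ _).sum_mem (fun o _ => ?_) ?_ (fun o _ => ?_)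
      · cases o with
        | none => exact div_nonneg (by positivity) hL0.le
        | some i => exact hc0 i
      · simpa [Fintype.sum_option, w] using hcsum
      · apply subset_convexHull
        cases o with
        | none => exact Or.inr rfl
        | some i => exact Or.inl (hq i)
    simpa [Fintype.sum_option, w, p] using h1
  have hy0 : v - y = 0 := by
    have : v - y ∈ ({0} : Set (Fin n → ℝ)) := hempty ▸ ⟨⟨hyZ, hyC⟩, hyP⟩
    exact this
  -- but the weight of the origin is less than one
  have hyv : v = y := sub_eq_zero.1 hy0
  have h1 : l (∑ i, c i • intPt (q i)) ≤ 0 := by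
    simp only [map_sum, map_smul, smul_eq_mul]
    exact Finset.sum_nonpos fun i _ => mul_nonpos_of_nonneg_of_nonpos (hc0 i) (hlq i).le
  rw [hcq, ← hyv, map_sub, map_smul, smul_eq_mul] at h1
  have h2 : (N + 1) / L < 1 := by
    rw [div_lt_one hL0]
    linarith
  rw [← hyv] at hly
  nlinarith

end Main

/-! ### The facet functional and the final estimate. -/

/-- The directions of the edges of a facet at a vertex span the direction of the facet: there are
linearly independent ones, and the facet direction is the kernel of the facet functional. -/
theorem exists_facet_basis {k m : ℕ} {P F : Set (Fin (k + 1) → ℝ)} {v : Fin (k + 1) → ℝ}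
    {l : StrongDual ℝ (Fin (k + 1) → ℝ)} (hl0 : l ≠ 0) (hFP : F ⊆ P) (hvF : v ∈ F)
    (hF : ∀ x ∈ F, l x = l v) (hFdim : affDim F = k)
    {R : Fin m → Fin (k + 1) → ℝ} (hR : ∀ i, l (R i) ≤ 0)
    (hcone : ∀ x ∈ P, x - v ∈ nonnegCone R) :
    vectorSpan ℝ F = LinearMap.ker (l : (Fin (k + 1) → ℝ) →ₗ[ℝ] ℝ) ∧
      ∃ f : Fin k → Fin m, (LinearIndependent ℝ fun j => R (f j)) ∧
        ∀ j, l (R (f j)) = 0 := by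
  set K := LinearMap.ker (l : (Fin (k + 1) → ℝ) →ₗ[ℝ] ℝ) with hK
  have hKmem : ∀ x, x ∈ K ↔ l x = 0 := fun x => by
    rw [hK, LinearMap.mem_ker]
    rfl
  have hKdim : Module.finrank ℝ K = k := by
    have h1 : (l : (Fin (k + 1) → ℝ) →ₗ[ℝ] ℝ) ≠ 0 := fun h => hl0 (by
      ext1 x
      exact LinearMap.congr_fun h x)
    have h2 := (l : (Fin (k + 1) → ℝ) →ₗ[ℝ] ℝ).finrank_range_add_finrank_ker
    change _ + Module.finrank ℝ K = _ at h2
    rw [LinearMap.range_eq_top.2 (LinearMap.surjective h1), finrank_top, Module.finrank_self,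
      Module.finrank_fin_fun] at h2
    omega
  let Z : Set (Fin (k + 1) → ℝ) := R '' {i | l (R i) = 0}
  have h1 : vectorSpan ℝ F ≤ Submodule.span ℝ Z := by
    rw [vectorSpan_eq_span_vsub_set_right ℝ hvF, Submodule.span_le]
    rintro _ ⟨x, hx, rfl⟩
    change x - v ∈ Submodule.span ℝ Z
    obtain ⟨c, hc, hcx⟩ := hcone x (hFP hx)
    -- A sum of nonpositive terms vanishes only termwise, so only directions in the kernel of `l`
    -- contribute to differences in `F`.
    have h2 : ∑ i, c i * l (R i) = 0 := by
      have := congrArg l hcx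
      simpa [hF x hx] using this
    have h3 : ∀ i, c i * l (R i) = 0 := by
      intro i
      refine (Finset.sum_eq_zero_iff_of_nonpos fun i _ => ?_).1 h2 i (Finset.mem_univ i)
      exact mul_nonpos_of_nonneg_of_nonpos (hc i) (hR i)
    rw [← hcx]
    refine Submodule.sum_mem _ fun i _ => ?_
    rcases mul_eq_zero.1 (h3 i) with h | h
    · rw [h, zero_smul]
      exact Submodule.zero_mem _
    · exact Submodule.smul_mem _ _ (Submodule.subset_span ⟨i, h, rfl⟩)
  have h2 : Submodule.span ℝ Z ≤ K := by
    rw [Submodule.span_le]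
    rintro _ ⟨i, hi, rfl⟩
    exact (hKmem _).2 hi
  have hFK : vectorSpan ℝ F = K :=
    Submodule.eq_of_le_of_finrank_eq (h1.trans h2) (by rw [hKdim]; exact hFdim)
  have hZK : Submodule.span ℝ Z = K := le_antisymm h2 (hFK ▸ h1)
  refine ⟨hFK, ?_⟩
  obtain ⟨b, hbZ, hbspan, hbind⟩ := exists_linearIndependent ℝ Z
  have hbfin : b.Finite := (Set.toFinite Z).subset hbZ
  have : Fintype b := hbfin.fintype
  have hcard : Fintype.card b = k := by
    have h3 := finrank_span_eq_card hbind
    rw [Subtype.range_coe, hbspan, hZK, hKdim] at h3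
    exact h3.symm
  let e : Fin k ≃ b := (Fintype.equivFinOfCardEq hcard).symm
  choose f hf using fun j : Fin k => hbZ (e j).2
  refine ⟨f, ?_, fun j => (hf j).1⟩
  have : (fun j => R (f j)) = (fun x : b => (x : Fin (k + 1) → ℝ)) ∘ e :=
    funext fun j => (hf j).2
  rw [this]
  exact hbind.comp e e.injective

theorem theorem6 (n : ℕ) (hn : 2 ≤ n)
    (P : Set (Fin n → ℝ)) (hP : IsIntegerConvexPolyhedron P) (hdim : affDim P = n)
    (hP0 : (0 : Fin n → ℝ) ∉ P)
    (v : Fin n → ℝ) (hv : IsVertexOf P v)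
    (hvint : v ∈ interior (convexHull ℝ (P ∪ {0})))
    (m : ℕ) (E : Fin m ≃ edgesAt P v)
    (r : Fin m → Fin n → ℤ) (hr : ∀ i, IsPrimitiveDirection (E i : Set (Fin n → ℝ)) (r i))
    (F : Set (Fin n → ℝ)) (hF : IsFaceOfDim P F (n - 1)) (hvF : v ∈ F)
    (hempty : (intLattice n ∩ convexHull ℝ (P ∪ {0})) \ P = {0}) :
    integerDistance F 0 < (((n * m) ^ (4 * n.factorial) * edgeStarDet r : ℕ) : ℕ∞) := by
  obtain ⟨k, rfl⟩ : ∃ k, n = k + 1 := ⟨n - 1, by omega⟩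
  rw [Nat.add_sub_cancel] at hF
  choose σ hσ hσP hσE using fun i => hv.exists_signed_direction hP (E i).2 (hr i)
  let q : Fin m → Fin (k + 1) → ℤ := fun i => σ i • r i
  have hq0 : ∀ i, intPt (q i) ≠ 0 := fun i => by
    simp only [q, intPt_zsmul]
    refine smul_ne_zero ?_ (hr i).1.ne_zero
    rcases hσ i with h | h <;> simp [h]
  have hcone : ∀ x ∈ P, x - v ∈ nonnegCone fun i => intPt (q i) := by
    refine hv.sub_mem_nonnegCone hP.1 _ fun e he x hx => ?_
    obtain ⟨i, hi⟩ := E.surjective ⟨e, he⟩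
    obtain ⟨c, hc, hcx⟩ := hσE i x (by rw [hi]; exact hx)
    rw [hcx]
    exact smul_mem_nonnegCone hc (mem_nonnegCone_self (fun i => intPt (q i)) i)
  -- the vertex as a combination of few edge directions
  obtain ⟨c, hc, hcv⟩ := mem_nonnegCone_of_mem_interior hP.1.1 hv.mem hvint hcone
  obtain ⟨d, s, hd, hds, hs, hdv⟩ := exists_nonneg_combination_card_le
    (fun i => intPt (q i)) c hc
  rw [Module.finrank_fin_fun] at hs
  have hvd : v = ∑ i, d i • intPt (q i) := by rw [hdv, hcv]
  obtain ⟨z₀, hz₀⟩ := hP.2 v hv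
  have hbound := one_add_sum_le_of_empty hn hv (hP.2 v hv) hempty q hσP hq0 d s hd hds hs hvd
  -- the facet functional
  obtain ⟨l, hl⟩ := hF.2.1 hF.1
  have hvmax : ∀ y ∈ P, l y ≤ l v := (hl ▸ hvF : v ∈ {x | x ∈ P ∧ ∀ y ∈ P, l y ≤ l x}).2
  have hl0 : l ≠ 0 := by
    rintro rfl
    have : F = P := by
      rw [hl]
      ext x
      simp
    rw [this, IsFaceOfDim, hdim] at hF
    have := hF.2.2
    omega
  have hlv := neg_of_isMax_of_mem_interior hP.1.1 hv.mem hvint hl0 hvmax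
  obtain ⟨hFK, f, hfind, hfl⟩ := exists_facet_basis (R := fun i => intPt (q i)) hl0
    hF.2.1.subset hvF (fun x hx => le_antisymm (hvmax x (hF.2.1.subset hx))
      ((hl ▸ hx : x ∈ {x | x ∈ P ∧ ∀ y ∈ P, l y ≤ l x}).2 v hv.mem)) hF.2.2
    (fun i => by
      have := hvmax _ (hσP i)
      rw [map_add] at this
      exact add_le_iff_nonpos_right _ |>.1 this) hcone
  have hspan : Submodule.span ℝ (range fun j => intPt (q (f j))) = vectorSpan ℝ F := by
    apply Submodule.eq_of_le_of_finrank_eq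
    · rw [hFK, Submodule.span_le]
      rintro _ ⟨j, rfl⟩
      exact hfl j
    · rw [finrank_span_eq_card hfind, Fintype.card_fin]
      exact hF.2.2.symm
  -- an integer functional vanishing on the direction of the facet
  obtain ⟨a, haR, haZ⟩ := exists_det_cons_eq_sum fun j => q (f j)
  have hker : ∀ w : Fin (k + 1) → ℝ, ∑ i, (a i : ℝ) * w i = 0 → w ∈ vectorSpan ℝ F := by
    intro w hw
    by_contra hcon
    rw [← hspan] at hcon
    have h1 : LinearIndependent ℝ (Fin.cons w fun j => intPt (q (f j)) :
        Fin (k + 1) → Fin (k + 1) → ℝ) := linearIndependent_finCons.2 ⟨hfind, hcon⟩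
    have h2 := (Matrix.linearIndependent_rows_iff_isUnit (A := Matrix.of (Fin.cons w
      fun j => intPt (q (f j)) : Fin (k + 1) → Fin (k + 1) → ℝ))).1 h1
    rw [Matrix.isUnit_iff_isUnit_det, haR, hw] at h2
    exact not_isUnit_zero h2
  -- This is w ↦ det(w, q (f 0), …), whose real kernel lies in the direction of `F`. It is nonzero
  -- at `v` because l v < 0.
  let ψ : (Fin (k + 1) → ℤ) →+ ℤ :=
    { toFun := fun w => ∑ i, a i * w i
      map_zero' := by simp
      map_add' := fun x y => by simp [mul_add, Finset.sum_add_distrib] }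
  have hψ : ∀ w, ((ψ w : ℤ) : ℝ) = ∑ i, (a i : ℝ) * intPt w i := fun w => by
    simp [ψ, intPt]
  have hψz : ψ z₀ ≠ 0 := by
    intro h
    have h1 := hker (intPt z₀) (by rw [← hψ, h, Int.cast_zero])
    rw [hz₀, hFK] at h1
    exact hlv.ne h1
  have hindex : integerDistance F 0 ≤ ((ψ z₀).natAbs : ℕ∞) := by
    refine enatCard_quotient_le_natAbs ψ z₀ hψz _ fun w hw => AddSubgroup.subset_closure ?_
    change intPt (w + 0) ∈ affineSpan ℝ F
    rw [add_zero]
    have h1 : intPt (w - z₀) ∈ vectorSpan ℝ F :=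
      hker _ (by rw [← hψ, map_sub, hw, sub_self, Int.cast_zero])
    rw [← direction_affineSpan] at h1
    have h2 := AffineSubspace.vadd_mem_of_mem_direction h1 (mem_affineSpan ℝ hvF)
    rwa [intPt_sub, hz₀, vadd_eq_add, sub_add_cancel] at h2
  -- comparison with the determinants of the edge star
  have hψq : ∀ i, |((ψ (q i) : ℤ) : ℝ)| ≤ edgeStarDet r := by
    intro i
    have h1 := natAbs_det_le_edgeStarDet q (Fin.cons i f)
    have h2 : (fun j => q ((Fin.cons i f : Fin (k + 1) → Fin m) j)) =
        Fin.cons (q i) fun j => q (f j) := by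
      funext j
      refine Fin.cases ?_ (fun j => ?_) j <;> simp
    rw [h2, haZ, edgeStarDet_sign_smul r σ hσ] at h1
    rw [← Int.cast_abs, Int.abs_eq_natAbs]
    exact_mod_cast h1
  have hψv : ((ψ z₀ : ℤ) : ℝ) = ∑ i, d i * (ψ (q i) : ℤ) := by
    rw [hψ, hz₀]
    conv_lhs => rw [hvd]
    simp only [hψ, Finset.sum_apply, Pi.smul_apply, smul_eq_mul, Finset.mul_sum]
    rw [Finset.sum_comm]
    exact Finset.sum_congr rfl fun i _ => Finset.sum_congr rfl fun j _ => by ring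
  have hle : |((ψ z₀ : ℤ) : ℝ)| ≤ (∑ i, d i) * edgeStarDet r := by
    rw [hψv, Finset.sum_mul]
    refine (Finset.abs_sum_le_sum_abs _ _).trans (Finset.sum_le_sum fun i _ => ?_)
    rw [abs_mul, abs_of_nonneg (hd i)]
    exact mul_le_mul_of_nonneg_left (hψq i) (hd i)
  have hpos : 0 < |((ψ z₀ : ℤ) : ℝ)| := abs_pos.2 (by exact_mod_cast hψz)
  have hdetpos : 0 < edgeStarDet r := by
    rcases Nat.eq_zero_or_pos (edgeStarDet r) with h | h
    · rw [h, Nat.cast_zero, mul_zero] at hle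
      linarith
    · exact h
  have hnm : k + 1 ≤ m := le_of_edgeStarDet_pos r hdetpos
  -- Strictness comes from the 1 in 1 + Σ d_i and the positive star determinant.
  have hlt : (ψ z₀).natAbs < (k + 1) ^ (8 * (k + 1).factorial) * edgeStarDet r := by
    have h1 : (((ψ z₀).natAbs : ℕ) : ℝ) = |((ψ z₀ : ℤ) : ℝ)| := by
      rw [← Int.cast_abs, Int.abs_eq_natAbs, Int.cast_natCast]
    have h2 : (0 : ℝ) < edgeStarDet r := by exact_mod_cast hdetpos
    have h3 : (((ψ z₀).natAbs : ℕ) : ℝ) <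
        (((k + 1) ^ (8 * (k + 1).factorial) : ℕ) : ℝ) * edgeStarDet r := by
      rw [h1]
      nlinarith
    exact_mod_cast h3
  have hpow : (k + 1) ^ (8 * (k + 1).factorial) ≤ ((k + 1) * m) ^ (4 * (k + 1).factorial) := by
    have h1 : 8 * (k + 1).factorial = 2 * (4 * (k + 1).factorial) := by ring
    rw [h1, pow_mul]
    apply Nat.pow_le_pow_left
    rw [sq]
    exact Nat.mul_le_mul_left _ hnm
  refine lt_of_le_of_lt hindex ?_
  exact_mod_cast hlt.trans_le (Nat.mul_le_mul_right _ hpow)
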